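/- Let $G=(V,E)$ be a finite simple undirected graph with a conductance assignment $c:E\to(0,\infty)$, and let $$\mathcal A_c(G)=\max\Bigl\{\frac{\sum_{e\in E(H)}c(e)}{|V(H)|-1} : H\subseteq G \text{ a connected subgraph},\ |V(H)|\ge 2\Bigr\}$$ be its weighted arboricity, where a maximum over an empty family is read as $0$. Suppose that $c(e)=1$ for every $e\in E$. Then $$\mathcal A_c(G)=\max_{\substack{H\subseteq G\text{ connected}\\ |V(H)|\ge 2}}\frac{|E(H)|}{|V(H)|-1}=\gamma(G),$$ where $\gamma(G)$ is the fractional arboricity of $G$, the maximum of $|E(H)|/(|V(H)|-1)$ over all subgraphs $H\subseteq G$, connected or not, with $|V(H)|\ge 2$. Moreover, $\lceil\mathcal A_c(G)\rceil$ is equal to the arboricity of $G$, that is, the minimum number of forests contained in $G$ whose union contains every edge of $G$. -/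

import Mathlib

noncomputable section

namespace WeightedArboricity

variable {V : Type*}

/-- A conductance assignment on `G`: a strictly positive real weight on every edge. -/
abbrev Conductance (G : SimpleGraph V) : Type _ := G.edgeSet → Set.Ioi (0 : ℝ)

/-- The weighted density `D_c(H) = (∑_{e ∈ E(H)} c(e)) / (|V(H)| - 1)`
(used only when `H` has at least two vertices). -/
def weightedDensity (G : SimpleGraph V) (c : Conductance G) (H : G.Subgraph) : ℝ :=
  (∑ᶠ e : H.edgeSet, (c ⟨e.1, H.edgeSet_subset e.2⟩ : ℝ)) / ((H.verts.ncard : ℝ) - 1)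

/-- The weighted densities of the connected subgraphs with at least two vertices. -/
def weightedDensities (G : SimpleGraph V) (c : Conductance G) : Set ℝ :=
  {x | ∃ H : G.Subgraph, H.Connected ∧ 2 ≤ H.verts.ncard ∧ x = weightedDensity G c H}

/-- The weighted arboricity `𝒜_c(G)`: the maximum of the weighted densities of the connected
subgraphs with at least two vertices. It is a maximum whenever `G` is finite and has an edge
(`isGreatest_weightedArboricity`); it is `0` for an edgeless graph. -/
def weightedArboricity (G : SimpleGraph V) (c : Conductance G) : ℝ :=
  sSup (weightedDensities G c)

/-- The density `|E(H)| / (|V(H)| - 1)` (used only when `H` has at least two vertices). -/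
def density (G : SimpleGraph V) (H : G.Subgraph) : ℝ :=
  (H.edgeSet.ncard : ℝ) / ((H.verts.ncard : ℝ) - 1)

/-- The densities of all subgraphs, connected or not, with at least two vertices. -/
def densities (G : SimpleGraph V) : Set ℝ :=
  {x | ∃ H : G.Subgraph, 2 ≤ H.verts.ncard ∧ x = density G H}

/-- The densities of the connected subgraphs with at least two vertices. -/
def connectedDensities (G : SimpleGraph V) : Set ℝ :=
  {x | ∃ H : G.Subgraph, H.Connected ∧ 2 ≤ H.verts.ncard ∧ x = density G H}

/-- The fractional arboricity `γ(G)`: the maximum of `|E(H)| / (|V(H)| - 1)` over all subgraphs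
with at least two vertices. It is a maximum whenever `G` is finite and has at least two vertices
(`isGreatest_fractionalArboricity`); it is `0` for a graph with at most one vertex. -/
def fractionalArboricity (G : SimpleGraph V) : ℝ :=
  sSup (densities G)

/-- The edges of `G` can be covered by `k` forests contained in `G`
(the forests need not be edge-disjoint, nor nonempty). -/
def CoveredByForests (G : SimpleGraph V) (k : ℕ) : Prop :=
  ∃ F : Fin k → SimpleGraph V, (∀ i, F i ≤ G ∧ (F i).IsAcyclic) ∧
    ∀ e ∈ G.edgeSet, ∃ i, e ∈ (F i).edgeSet

/-- The arboricity of `G`: the minimum number of forests covering all edges of `G`. For finite `G`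
this minimum exists (`isLeast_arboricity`). -/
def arboricity (G : SimpleGraph V) : ℕ :=
  sInf {k | CoveredByForests G k}

theorem isGreatest_weightedArboricity [Finite V] (G : SimpleGraph V) (c : Conductance G)
    (h : G.edgeSet.Nonempty) : IsGreatest (weightedDensities G c) (weightedArboricity G c) := by
  have hfin : (weightedDensities G c).Finite :=
    (Set.finite_range (weightedDensity G c)).subset (by rintro x ⟨H, -, -, rfl⟩; exact ⟨H, rfl⟩)
  have hne : (weightedDensities G c).Nonempty := by
    obtain ⟨e, he⟩ := h
    induction e using Sym2.ind with
    | _ u v =>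
      have huv : G.Adj u v := he
      refine ⟨_, G.subgraphOfAdj huv, SimpleGraph.Subgraph.subgraphOfAdj_connected huv, ?_, rfl⟩
      simp [Set.ncard_pair huv.ne]
  exact ⟨hne.csSup_mem hfin, fun x hx => le_csSup hfin.bddAbove hx⟩

theorem isGreatest_fractionalArboricity [Finite V] [Nontrivial V] (G : SimpleGraph V) :
    IsGreatest (densities G) (fractionalArboricity G) := by
  have hfin : (densities G).Finite :=
    (Set.finite_range (density G)).subset (by rintro x ⟨H, -, rfl⟩; exact ⟨H, rfl⟩)
  have hne : (densities G).Nonempty := by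
    refine ⟨_, ⊤, ?_, rfl⟩
    rw [SimpleGraph.Subgraph.verts_top, Set.ncard_univ]
    exact Finite.one_lt_card
  exact ⟨hne.csSup_mem hfin, fun x hx => le_csSup hfin.bddAbove hx⟩

theorem isLeast_arboricity [Finite V] (G : SimpleGraph V) :
    IsLeast {k | CoveredByForests G k} (arboricity G) := by
  have hne : {k | CoveredByForests G k}.Nonempty := by
    obtain ⟨n, ⟨f⟩⟩ := Finite.exists_equiv_fin V
    refine ⟨n, fun i => SimpleGraph.starGraph (f.symm i) ⊓ G, fun i => ⟨inf_le_right,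
      (SimpleGraph.isAcyclic_starGraph (f.symm i)).anti inf_le_left⟩, fun e he => ?_⟩
    induction e using Sym2.ind with
    | _ u v =>
      have huv : G.Adj u v := he
      refine ⟨f u, ?_⟩
      simp [huv, huv.ne]
  exact ⟨Nat.sInf_mem hne, fun k hk => Nat.sInf_le hk⟩

end WeightedArboricity

end

/-! Unit conductances turn weighted densities into ordinary ones. Disconnected subgraphs add
nothing: splitting along a component only improves the edge bound
(`ncard_edgeSet_le_mul_of_connected`). A forest has at most |X| - 1 edges within a nonempty X, so a
cover by k forests forces γ ≤ k. The converse is Nash-Williams' theorem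
(`exists_coloring_isAcyclic`), proved by coloring edges one at a time. If an edge e₀ gets stuck, let
S consist of all edges that exchanges can leave uncolored in its place. Every color class within S -
e₀ spans the component X of S containing e₀, so X carries k(|X| - 1) colored edges plus e₀, too many
for the hypothesis. -/

namespace WeightedArboricity

open SimpleGraph

variable {V : Type*}

/-! ### Edge counts of forests on vertex sets -/

/-- The members of `T` with all endpoints in `X`. -/
def edgesWithin (T : Set (Sym2 V)) (X : Set V) : Set (Sym2 V) :=
  {e ∈ T | ∀ v ∈ e, v ∈ X}

theorem ncard_edgesWithin_edgeSet (F : SimpleGraph V) (X : Set V) :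
    (edgesWithin F.edgeSet X).ncard = (F.induce X).edgeSet.ncard := by
  have h : edgesWithin F.edgeSet X = Sym2.map Subtype.val '' (F.induce X).edgeSet := by
    ext e
    induction e using Sym2.ind with
    | _ a b =>
      constructor
      · rintro ⟨hab, hX⟩
        exact ⟨s(⟨a, hX a (by simp)⟩, ⟨b, hX b (by simp)⟩), by simpa using hab, rfl⟩
      · rintro ⟨e', he', heq⟩
        induction e' using Sym2.ind with
        | _ x y =>
          rw [← heq]
          refine ⟨by simpa using he', ?_⟩
          simp only [Sym2.map_mk, Sym2.mem_iff]
          rintro v (rfl | rfl)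
          exacts [x.2, y.2]
  rw [h, Set.ncard_image_of_injective _ (Sym2.map.injective Subtype.val_injective)]

/-- A forest extends to a spanning tree of the complete graph. -/
theorem ncard_edgeSet_add_one_le_of_isAcyclic [Finite V] [Nonempty V] {F : SimpleGraph V}
    (hF : F.IsAcyclic) : F.edgeSet.ncard + 1 ≤ Nat.card V := by
  obtain ⟨T, hle, -, hT⟩ :=
    (connected_top (V := V)).exists_isTree_le_of_le_of_isAcyclic le_top hF
  rw [← (isTree_iff_connected_and_card.1 hT).2]
  exact Nat.add_le_add_right (Set.ncard_le_ncard (edgeSet_mono hle) (Set.toFinite _)) 1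

theorem ncard_edgesWithin_add_one_le_of_isAcyclic [Finite V] {F : SimpleGraph V}
    (hF : F.IsAcyclic) {X : Set V} (hX : X.Nonempty) :
    (edgesWithin F.edgeSet X).ncard + 1 ≤ X.ncard := by
  have := hX.to_subtype
  rw [ncard_edgesWithin_edgeSet]
  exact ncard_edgeSet_add_one_le_of_isAcyclic (hF.induce X)

theorem ncard_le_ncard_edgesWithin_add_one [Finite V] {F : SimpleGraph V} {X : Set V}
    (hF : (F.induce X).Connected) : X.ncard ≤ (edgesWithin F.edgeSet X).ncard + 1 := by
  rw [ncard_edgesWithin_edgeSet]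
  exact hF.card_vert_le_card_edgeSet_add_one

theorem reachable_of_forall_adj_reachable {G H : SimpleGraph V}
    (h : ∀ a b, G.Adj a b → H.Reachable a b) {a b : V} (hab : G.Reachable a b) :
    H.Reachable a b := by
  obtain ⟨p⟩ := hab
  induction p with
  | nil => rfl
  | cons hadj _ ih => exact (h _ _ hadj).trans ih

/-- Paths in a forest are unique: a walk avoiding `f` would shorten to `p`, which uses `f`. -/
theorem not_reachable_deleteEdges_of_mem_edges {F : SimpleGraph V} (hF : F.IsAcyclic) {u v : V}
    {p : F.Walk u v} (hp : p.IsPath) {f : Sym2 V} (hf : f ∈ p.edges) :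
    ¬ (F.deleteEdges {f}).Reachable u v := by
  induction f using Sym2.ind
  rw [reachable_deleteEdges_iff_exists_walk]
  rintro ⟨q, hq⟩
  classical
  have h := congrArg Subtype.val ((hF.subsingleton_path u v).elim ⟨p, hp⟩ q.toPath)
  apply hq
  apply q.edges_toPath_subset_edges
  rw [← h]
  exact hf

/-! ### Edge exchanges and Nash-Williams' coloring -/

variable {ι : Type*}

/-- The graph formed by the edges of `T` with color `i`, apart from `e`. -/
def colorClass (T : Set (Sym2 V)) (c : Sym2 V → ι) (e : Sym2 V) (i : ι) : SimpleGraph V :=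
  fromEdgeSet {x ∈ T | x ≠ e ∧ c x = i}

theorem colorClass_adj {T : Set (Sym2 V)} {c : Sym2 V → ι} {e : Sym2 V} {i : ι} {a b : V} :
    (colorClass T c e i).Adj a b ↔ (s(a, b) ∈ T ∧ s(a, b) ≠ e ∧ c s(a, b) = i) ∧ a ≠ b :=
  fromEdgeSet_adj _

open Classical in
/-- An exchange: the edge `p.2`, left uncolored so far, receives the color of `q.2`, which is left
uncolored instead, and the color classes stay acyclic. -/
def Exchange (T : Set (Sym2 V)) (p q : (Sym2 V → ι) × Sym2 V) : Prop :=
  q.2 ∈ T ∧ q.2 ≠ p.2 ∧ q.1 = Function.update p.1 p.2 (p.1 q.2) ∧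
    ∀ i, (colorClass T q.1 q.2 i).IsAcyclic

open Classical in
/-- If no coloring has acyclic classes, then the ends of the uncolored edge are joined in each color
class by a path all of whose edges can be exchanged for it. -/
theorem exists_walk_forall_exchange {T : Set (Sym2 V)}
    (hT : ¬ ∃ c : Sym2 V → ι, ∀ i, (fromEdgeSet {x ∈ T | c x = i}).IsAcyclic)
    {c : Sym2 V → ι} {u v : V} (hc : ∀ i, (colorClass T c s(u, v) i).IsAcyclic) (i : ι) :
    ∃ p : (colorClass T c s(u, v) i).Walk u v, ∀ f ∈ p.edges,
      Exchange T (c, s(u, v)) (Function.update c s(u, v) (c f), f) := by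
  -- Otherwise giving s(u, v) color `i` closes no cycle and colors all of `T`.
  have hreach : (colorClass T c s(u, v) i).Reachable u v := by
    by_contra hnr
    refine hT ⟨Function.update c s(u, v) i, fun j => ?_⟩
    by_cases hj : j = i
    · subst hj
      refine ((hc j).sup_edge_of_not_reachable hnr).anti fun a b hab => ?_
      simp only [fromEdgeSet_adj, Set.mem_ofPred_eq] at hab
      by_cases he : s(a, b) = s(u, v)
      · exact Or.inr (by simpa [edge, he] using hab.2)
      · exact Or.inl (colorClass_adj.2 ⟨⟨hab.1.1, he, by simpa [he] using hab.1.2⟩, hab.2⟩)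
    · refine (hc j).anti fun a b hab => ?_
      simp only [fromEdgeSet_adj, Set.mem_ofPred_eq] at hab
      by_cases he : s(a, b) = s(u, v)
      · rw [he, Function.update_self] at hab
        exact absurd hab.1.2.symm hj
      · exact colorClass_adj.2 ⟨⟨hab.1.1, he, by simpa [he] using hab.1.2⟩, hab.2⟩
  obtain ⟨p, hp⟩ := hreach.exists_isPath
  refine ⟨p, fun f hf => ?_⟩
  have hfi : (f ∈ T ∧ f ≠ s(u, v) ∧ c f = i) := by
    have := p.edges_subset_edgeSet hf
    rw [colorClass, edgeSet_fromEdgeSet] at this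
    exact this.1
  refine ⟨hfi.1, hfi.2.1, rfl, fun j => ?_⟩
  by_cases hj : j = i
  · subst hj
    -- Uncoloring `f` separates `u` from `v`, so s(u, v) can take its color.
    have hnr := not_reachable_deleteEdges_of_mem_edges (hc j) hp hf
    refine (((hc j).anti (deleteEdges_le _)).sup_edge_of_not_reachable hnr).anti fun a b hab => ?_
    simp only [colorClass_adj] at hab
    by_cases he : s(a, b) = s(u, v)
    · exact Or.inr (by simpa [edge, he] using hab.2)
    · refine Or.inl ?_
      rw [deleteEdges_adj, colorClass_adj]
      exact ⟨⟨⟨hab.1.1, he, by simpa [he] using hab.1.2.2⟩, hab.2⟩, hab.1.2.1⟩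
  · refine (hc j).anti fun a b hab => ?_
    simp only [colorClass_adj] at hab
    by_cases he : s(a, b) = s(u, v)
    · rw [he, Function.update_self] at hab
      exact absurd (hab.1.2.2.symm.trans hfi.2.2) hj
    · exact colorClass_adj.2 ⟨⟨hab.1.1, he, by simpa [he] using hab.1.2.2⟩, hab.2⟩

/-- If the edges of `T` other than `e₀` can be colored with acyclic classes but those of `T` cannot,
then `e₀` lies in a set `S ⊆ T` each edge of which is spanned by each color class within `S`. -/
theorem exists_subset_forall_colorClass_reachable {T : Set (Sym2 V)}
    (hT : ¬ ∃ c : Sym2 V → ι, ∀ i, (fromEdgeSet {x ∈ T | c x = i}).IsAcyclic)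
    {c₀ : Sym2 V → ι} {e₀ : Sym2 V} (he₀ : e₀ ∈ T)
    (hc₀ : ∀ i, (colorClass T c₀ e₀ i).IsAcyclic) :
    ∃ S ⊆ T, e₀ ∈ S ∧ ∀ a b, s(a, b) ∈ S → ∀ i, (colorClass S c₀ e₀ i).Reachable a b := by
  classical
  let R := Relation.ReflTransGen (Exchange (ι := ι) T)
  let S : Set (Sym2 V) := {e | ∃ c, R (c₀, e₀) (c, e)}
  have hacyc : ∀ q, R (c₀, e₀) q → q.2 ∈ T ∧ ∀ i, (colorClass T q.1 q.2 i).IsAcyclic := by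
    intro q hq
    cases hq with
    | refl => exact ⟨he₀, hc₀⟩
    | tail _ h => exact ⟨h.1, h.2.2.2⟩
  -- The path's edges are exchangeable, hence themselves in `S`.
  have hfund : ∀ q, R (c₀, e₀) q → ∀ a b, q.2 = s(a, b) → ∀ i,
      (colorClass S q.1 q.2 i).Reachable a b := by
    rintro ⟨c, e⟩ hq a b rfl i
    obtain ⟨p, hp⟩ := exists_walk_forall_exchange hT (hacyc _ hq).2 i
    refine ⟨p.transfer _ fun f hf => ?_⟩
    have hmem := p.edges_subset_edgeSet hf
    rw [colorClass, edgeSet_fromEdgeSet] at hmem ⊢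
    exact ⟨⟨⟨_, hq.tail (hp f hf)⟩, hmem.1.2⟩, hmem.2⟩
  -- Undo exchanges one by one: the only edge a class can have gained is `q.2`, whose ends `hfund`
  -- already joins in the earlier class.
  have hmono : ∀ q, R (c₀, e₀) q → ∀ i a b, (colorClass S q.1 q.2 i).Reachable a b →
      (colorClass S c₀ e₀ i).Reachable a b := by
    intro q hq
    induction hq with
    | refl => exact fun _ _ _ h => h
    | @tail q r hq hqr ih =>
      intro i a b hab
      refine ih i a b (reachable_of_forall_adj_reachable (fun x y hxy => ?_) hab)
      rw [colorClass_adj] at hxy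
      by_cases he : s(x, y) = q.2
      · exact hfund q hq x y he.symm i
      · refine Adj.reachable (colorClass_adj.2 ⟨⟨hxy.1.1, he, ?_⟩, hxy.2⟩)
        simpa [hqr.2.2.1, he] using hxy.1.2.2
  refine ⟨S, ?_, ⟨c₀, Relation.ReflTransGen.refl⟩, ?_⟩
  · rintro e ⟨c, hc⟩
    exact (hacyc _ hc).1
  · rintro a b ⟨c, hc⟩ i
    exact hmono _ hc i a b (hfund _ hc a b rfl i)

/-- The hard part of Nash-Williams' arboricity theorem, in terms of colorings. -/
theorem exists_coloring_isAcyclic [Finite V] [Fintype ι] [Nonempty ι] (T : Set (Sym2 V))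
    (hT : ∀ X : Set V, X.Nonempty →
      (edgesWithin T X).ncard + Fintype.card ι ≤ Fintype.card ι * X.ncard) :
    ∃ c : Sym2 V → ι, ∀ i, (fromEdgeSet {x ∈ T | c x = i}).IsAcyclic := by
  induction T, Set.toFinite T using Set.Finite.induction_on with
  | empty => exact ⟨fun _ => Classical.arbitrary ι, fun i => by simp⟩
  | @insert e₀ T he₀ _ ih =>
    obtain ⟨c₀, hc₀⟩ := ih fun X hX => (Nat.add_le_add_right (Set.ncard_le_ncard
      (t := edgesWithin (insert e₀ T) X)
      (fun e he => ⟨Or.inr he.1, he.2⟩) (Set.toFinite _)) _).trans (hT X hX)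
    by_contra hcon
    obtain ⟨S, hST, heS, hS⟩ := exists_subset_forall_colorClass_reachable hcon
      (Set.mem_insert e₀ T) (c₀ := c₀) fun i => (hc₀ i).anti (fromEdgeSet_mono (by
        rintro x ⟨hx, hne, hxi⟩
        exact ⟨hx.resolve_left hne, hxi⟩))
    obtain ⟨u, v, rfl⟩ : ∃ u v, e₀ = s(u, v) := by
      induction e₀ using Sym2.ind with | _ u v => exact ⟨u, v, rfl⟩
    set X : Set V := {w | (fromEdgeSet S).Reachable u w} with hX
    have hcard : ∀ i, X.ncard ≤
        (edgesWithin (colorClass S c₀ s(u, v) i).edgeSet X).ncard + 1 := by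
      intro i
      apply ncard_le_ncard_edgesWithin_add_one
      have hsupp : X = ((colorClass S c₀ s(u, v) i).connectedComponentMk u).supp := by
        ext w
        rw [ConnectedComponent.mem_supp_iff, ConnectedComponent.eq]
        constructor
        · intro h
          exact (reachable_of_forall_adj_reachable (fun a b hab => hS a b
            ((fromEdgeSet_adj _).1 hab).1 i) h).symm
        · intro h
          exact h.symm.mono (fromEdgeSet_mono fun x hx => hx.1)
      rw [hsupp]
      exact ConnectedComponent.connected_toSimpleGraph _
    have huv : s(u, v) ∈ edgesWithin (insert s(u, v) T) X := by
      refine ⟨Set.mem_insert _ _, fun w hw => ?_⟩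
      rcases Sym2.mem_iff.1 hw with rfl | rfl
      · exact Reachable.refl _
      -- Reachability, unlike adjacency, needs no `u ≠ v`; `T` may contain loops.
      · exact (hS _ _ heS (Classical.arbitrary ι)).mono (fromEdgeSet_mono fun x hx => hx.1)
    classical
    have := Fintype.ofFinite V
    have hsum := Finset.card_eq_sum_card_fiberwise (f := c₀) (t := Finset.univ)
      (s := (edgesWithin (insert s(u, v) T) X \ {s(u, v)}).toFinset) (by simp)
    rw [← Set.ncard_eq_toFinset_card'] at hsum
    have hle : Fintype.card ι * X.ncard ≤
        (edgesWithin (insert s(u, v) T) X \ {s(u, v)}).ncard + Fintype.card ι := by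
      have : Fintype.card ι * X.ncard = ∑ _i : ι, X.ncard := by simp
      rw [this, hsum, ← Finset.card_univ, Finset.card_eq_sum_ones, ← Finset.sum_add_distrib]
      refine Finset.sum_le_sum fun i _ => (hcard i).trans (Nat.add_le_add_right ?_ 1)
      rw [← Set.ncard_coe_finset]
      refine Set.ncard_le_ncard (fun x hx => ?_) (Set.toFinite _)
      obtain ⟨hx, hxX⟩ := hx
      rw [colorClass, edgeSet_fromEdgeSet] at hx
      simpa using ⟨⟨⟨hST hx.1.1, hxX⟩, hx.1.2.1⟩, hx.1.2.2⟩
    -- The uncolored edge is the one too many.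
    have h1 := Set.ncard_sdiff_singleton_add_one huv (Set.toFinite _)
    have h2 := hT X ⟨u, Reachable.refl _⟩
    lia

/-! ### Reduction to connected subgraphs -/

theorem weightedDensity_eq_density [Finite V] {G : SimpleGraph V} {c : Conductance G}
    (hc : ∀ e : G.edgeSet, (c e : ℝ) = 1) (H : G.Subgraph) :
    weightedDensity G c H = density G H := by
  have := Fintype.ofFinite H.edgeSet
  simp only [weightedDensity, density, hc, finsum_eq_sum_of_fintype, Finset.sum_const,
    nsmul_eq_mul, mul_one, Finset.card_univ]
  rw [← Nat.card_eq_fintype_card, Nat.card_coe_set_eq]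

theorem weightedDensities_eq_connectedDensities [Finite V] {G : SimpleGraph V} {c : Conductance G}
    (hc : ∀ e : G.edgeSet, (c e : ℝ) = 1) : weightedDensities G c = connectedDensities G := by
  simp only [weightedDensities, connectedDensities, weightedDensity_eq_density hc]

theorem bddAbove_densities [Finite V] (G : SimpleGraph V) : BddAbove (densities G) :=
  ((Set.finite_range (density G)).subset (by rintro x ⟨H, -, rfl⟩; exact ⟨H, rfl⟩)).bddAbove

theorem connectedDensities_subset_densities (G : SimpleGraph V) :
    connectedDensities G ⊆ densities G := by
  rintro x ⟨H, -, hH, rfl⟩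
  exact ⟨H, hH, rfl⟩

theorem density_le_iff {G : SimpleGraph V} {H : G.Subgraph} (hH : 2 ≤ H.verts.ncard) {x : ℝ} :
    density G H ≤ x ↔ (H.edgeSet.ncard : ℝ) ≤ x * ((H.verts.ncard : ℝ) - 1) := by
  have : (2 : ℝ) ≤ H.verts.ncard := by exact_mod_cast hH
  exact div_le_iff₀ (by linarith)

theorem density_nonneg {G : SimpleGraph V} {H : G.Subgraph} (hH : 2 ≤ H.verts.ncard) :
    0 ≤ density G H := by
  have : (2 : ℝ) ≤ H.verts.ncard := by exact_mod_cast hH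
  exact div_nonneg (Nat.cast_nonneg _) (by linarith)

theorem sSup_connectedDensities_nonneg (G : SimpleGraph V) : 0 ≤ sSup (connectedDensities G) :=
  Real.sSup_nonneg (by rintro x ⟨H, -, hH, rfl⟩; exact density_nonneg hH)

theorem fractionalArboricity_nonneg (G : SimpleGraph V) : 0 ≤ fractionalArboricity G :=
  Real.sSup_nonneg (by rintro x ⟨H, hH, rfl⟩; exact density_nonneg hH)

/-- A subgraph that is not connected splits into two parts with no edges between them. -/
theorem exists_verts_split_of_not_connected {G : SimpleGraph V} {H : G.Subgraph}
    (hne : H.verts.Nonempty) (hH : ¬ H.Connected) :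
    ∃ A ⊆ H.verts, A.Nonempty ∧ (H.verts \ A).Nonempty ∧
      ∀ a b, H.Adj a b → (a ∈ A ↔ b ∈ A) := by
  have := hne.to_subtype
  have hpre : ¬ H.coe.Preconnected := fun h => hH ⟨⟨h⟩⟩
  obtain ⟨a, b, hab⟩ : ∃ a b, ¬ H.coe.Reachable a b := by
    simpa only [Preconnected, not_forall] using hpre
  refine ⟨Subtype.val '' {w | H.coe.Reachable a w}, ?_, ⟨a, a, Reachable.refl _, rfl⟩,
    ⟨b, b.2, ?_⟩, ?_⟩
  · rintro _ ⟨w, -, rfl⟩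
    exact w.2
  · rintro ⟨w, hw, hwb⟩
    exact hab (Subtype.ext hwb ▸ hw)
  · have key : ∀ x y, H.Adj x y → x ∈ Subtype.val '' {w | H.coe.Reachable a w} →
        y ∈ Subtype.val '' {w | H.coe.Reachable a w} := by
      rintro _ y hxy ⟨x, hx, rfl⟩
      exact ⟨⟨y, H.edge_vert hxy.symm⟩, Reachable.trans hx (Adj.reachable hxy), rfl⟩
    exact fun x y hxy => ⟨key x y hxy, key y x hxy.symm⟩

theorem edgeSet_eq_empty_of_ncard_verts_le_one [Finite V] {G : SimpleGraph V} {H : G.Subgraph}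
    (hH : H.verts.ncard ≤ 1) : H.edgeSet = ∅ := by
  refine Set.eq_empty_of_forall_notMem fun e he => ?_
  induction e using Sym2.ind with
  | _ a b =>
    have hab : H.Adj a b := he
    exact hab.ne ((Set.ncard_le_one (Set.toFinite _)).1 hH a (H.edge_vert hab) b
      (H.edge_vert hab.symm))

/-- The bounds for two parts without edges between them add up to M(|V(H)| - 2), with M ≥ 0 to
spare. -/
theorem ncard_edgeSet_le_mul_of_connected [Finite V] {G : SimpleGraph V} {M : ℝ} (hM₀ : 0 ≤ M)
    (hM : ∀ H : G.Subgraph, H.Connected → 2 ≤ H.verts.ncard →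
      (H.edgeSet.ncard : ℝ) ≤ M * ((H.verts.ncard : ℝ) - 1))
    (H : G.Subgraph) (hne : H.verts.Nonempty) :
    (H.edgeSet.ncard : ℝ) ≤ M * ((H.verts.ncard : ℝ) - 1) := by
  induction hn : H.verts.ncard using Nat.strong_induction_on generalizing H with
  | _ n ih =>
    subst hn
    have hpos : 1 ≤ H.verts.ncard := hne.ncard_pos (Set.toFinite _)
    have hpos' : (1 : ℝ) ≤ H.verts.ncard := by exact_mod_cast hpos
    by_cases hH : H.Connected
    · rcases Nat.lt_or_ge H.verts.ncard 2 with h1 | h2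
      · rw [edgeSet_eq_empty_of_ncard_verts_le_one (by lia), Set.ncard_empty]
        exact mul_nonneg hM₀ (by linarith) |>.trans_eq' (by simp)
      · exact hM H hH h2
    · obtain ⟨A, hA, hAne, hBne, hadj⟩ := exists_verts_split_of_not_connected hne hH
      have hcard := Set.ncard_sdiff_add_ncard_of_subset hA (Set.toFinite _)
      have hApos := hAne.ncard_pos (Set.toFinite _)
      have hBpos := hBne.ncard_pos (Set.toFinite _)
      have h1 := ih A.ncard (by lia) (H.induce A) hAne rfl
      have h2 := ih (H.verts \ A).ncard (by lia) (H.induce (H.verts \ A)) hBne rfl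
      have hsub : H.edgeSet ⊆ (H.induce A).edgeSet ∪ (H.induce (H.verts \ A)).edgeSet := by
        intro e he
        induction e using Sym2.ind with
        | _ a b =>
          have hab : H.Adj a b := he
          by_cases ha : a ∈ A
          · exact Or.inl ⟨ha, (hadj a b hab).1 ha, hab⟩
          · exact Or.inr ⟨⟨H.edge_vert hab, ha⟩,
              ⟨H.edge_vert hab.symm, fun hb => ha ((hadj a b hab).2 hb)⟩, hab⟩
      have hE : (H.edgeSet.ncard : ℝ) ≤
          (H.induce A).edgeSet.ncard + (H.induce (H.verts \ A)).edgeSet.ncard := by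
        exact_mod_cast (Set.ncard_le_ncard hsub (Set.toFinite _)).trans (Set.ncard_union_le _ _)
      have hcard' : (H.verts.ncard : ℝ) = (H.verts \ A).ncard + A.ncard := by
        exact_mod_cast hcard.symm
      rw [hcard']
      linarith

theorem ncard_edgeSet_le_sSup_connectedDensities_mul [Finite V] {G : SimpleGraph V}
    (H : G.Subgraph) (hne : H.verts.Nonempty) :
    (H.edgeSet.ncard : ℝ) ≤ sSup (connectedDensities G) * ((H.verts.ncard : ℝ) - 1) := by
  refine ncard_edgeSet_le_mul_of_connected (sSup_connectedDensities_nonneg G)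
    (fun H hH h2 => (density_le_iff h2).1 ?_) H hne
  exact le_csSup ((bddAbove_densities G).mono (connectedDensities_subset_densities G))
    ⟨H, hH, h2, rfl⟩

theorem sSup_connectedDensities_eq_fractionalArboricity [Finite V] (G : SimpleGraph V) :
    sSup (connectedDensities G) = fractionalArboricity G := by
  apply le_antisymm
  · exact Real.sSup_le (fun x hx => le_csSup (bddAbove_densities G)
      (connectedDensities_subset_densities G hx)) (fractionalArboricity_nonneg G)
  · refine Real.sSup_le ?_ (sSup_connectedDensities_nonneg G)
    rintro x ⟨H, hH, rfl⟩
    exact (density_le_iff hH).2 (ncard_edgeSet_le_sSup_connectedDensities_mul H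
      (Set.nonempty_of_ncard_ne_zero (by lia)))

/-! ### Comparison with arboricity -/

theorem fractionalArboricity_le_of_coveredByForests [Finite V] {G : SimpleGraph V} {k : ℕ}
    (h : CoveredByForests G k) : fractionalArboricity G ≤ k := by
  refine Real.sSup_le ?_ (Nat.cast_nonneg k)
  rintro x ⟨H, hH, rfl⟩
  obtain ⟨F, hF, hcov⟩ := h
  have hsub : H.edgeSet ⊆ ⋃ i, edgesWithin (F i).edgeSet H.verts := by
    intro e he
    obtain ⟨i, hi⟩ := hcov e (H.edgeSet_subset he)
    exact Set.mem_iUnion.2 ⟨i, hi, fun v hv => H.mem_verts_of_mem_edge he hv⟩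
  have hcard : H.edgeSet.ncard ≤ k * (H.verts.ncard - 1) := by
    calc H.edgeSet.ncard
        ≤ (⋃ i, edgesWithin (F i).edgeSet H.verts).ncard :=
          Set.ncard_le_ncard hsub (Set.toFinite _)
      _ ≤ ∑ i, (edgesWithin (F i).edgeSet H.verts).ncard := Set.ncard_iUnion_le_of_fintype _
      _ ≤ ∑ _i : Fin k, (H.verts.ncard - 1) := Finset.sum_le_sum fun i _ =>
          Nat.le_sub_one_of_lt (ncard_edgesWithin_add_one_le_of_isAcyclic (hF i).2
            (Set.nonempty_of_ncard_ne_zero (by lia)))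
      _ = k * (H.verts.ncard - 1) := by simp
  rw [density_le_iff hH, ← Nat.cast_one, ← Nat.cast_sub (by lia)]
  exact_mod_cast hcard

/-- **Nash-Williams' arboricity theorem**. -/
theorem coveredByForests_of_forall_ncard_edgesWithin_le [Finite V] {G : SimpleGraph V} {k : ℕ}
    (h : ∀ X : Set V, X.Nonempty → (edgesWithin G.edgeSet X).ncard + k ≤ k * X.ncard) :
    CoveredByForests G k := by
  -- The coloring theorem needs a color; for `k = 0` the bound on the whole vertex set leaves no
  -- edges.
  rcases Nat.eq_zero_or_pos k with rfl | hk
  · refine ⟨fun _ => ⊥, fun i => i.elim0, fun e he => ?_⟩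
    induction e using Sym2.ind with
    | _ a b =>
      have h0 := h Set.univ ⟨a, trivial⟩
      rw [zero_mul, add_zero, Nat.le_zero, Set.ncard_eq_zero (Set.toFinite _)] at h0
      exact absurd (show s(a, b) ∈ edgesWithin G.edgeSet Set.univ from
        ⟨he, fun _ _ => trivial⟩) (h0 ▸ Set.notMem_empty _)
  · have : Nonempty (Fin k) := ⟨⟨0, hk⟩⟩
    obtain ⟨c, hc⟩ := exists_coloring_isAcyclic (ι := Fin k) G.edgeSet (by simpa using h)
    refine ⟨fun i => fromEdgeSet {x ∈ G.edgeSet | c x = i}, fun i => ⟨?_, hc i⟩,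
      fun e he => ⟨c e, ?_⟩⟩
    · intro a b hab
      exact ((fromEdgeSet_adj _).1 hab).1.1
    · rw [edgeSet_fromEdgeSet]
      exact ⟨⟨he, rfl⟩, G.not_isDiag_of_mem_edgeSet he⟩

theorem coveredByForests_natCeil_sSup_connectedDensities [Finite V] (G : SimpleGraph V) :
    CoveredByForests G ⌈sSup (connectedDensities G)⌉₊ := by
  apply coveredByForests_of_forall_ncard_edgesWithin_le
  intro X hX
  have hE : edgesWithin G.edgeSet X ⊆ ((⊤ : G.Subgraph).induce X).edgeSet := by
    rintro e ⟨he, heX⟩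
    induction e using Sym2.ind with
    | _ a b => exact ⟨heX a (by simp), heX b (by simp), he⟩
  have h1 : ((edgesWithin G.edgeSet X).ncard : ℝ) ≤
      ((⊤ : G.Subgraph).induce X).edgeSet.ncard := by
    exact_mod_cast Set.ncard_le_ncard hE (Set.toFinite _)
  have h2 := ncard_edgeSet_le_sSup_connectedDensities_mul ((⊤ : G.Subgraph).induce X) hX
  rw [Subgraph.induce_verts] at h2
  have h3 := Nat.le_ceil (sSup (connectedDensities G))
  have h4 : (1 : ℝ) ≤ X.ncard := by exact_mod_cast hX.ncard_pos (Set.toFinite _)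
  have h5 := mul_le_mul_of_nonneg_right h3 (sub_nonneg.2 h4)
  have h6 : ((edgesWithin G.edgeSet X).ncard : ℝ) + ⌈sSup (connectedDensities G)⌉₊ ≤
      ⌈sSup (connectedDensities G)⌉₊ * X.ncard := by linarith
  exact_mod_cast h6

theorem natCeil_sSup_connectedDensities_eq_arboricity [Finite V] (G : SimpleGraph V) :
    ⌈sSup (connectedDensities G)⌉₊ = arboricity G := by
  apply le_antisymm
  · rw [Nat.ceil_le, sSup_connectedDensities_eq_fractionalArboricity]
    exact fractionalArboricity_le_of_coveredByForests (isLeast_arboricity G).1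
  · exact (isLeast_arboricity G).2 (coveredByForests_natCeil_sSup_connectedDensities G)

end WeightedArboricity

open WeightedArboricity in
theorem proposition3p1 {V : Type*} [Finite V] (G : SimpleGraph V) (c : Conductance G)
    (hc : ∀ e : G.edgeSet, (c e : ℝ) = 1) :
    (G.edgeSet.Nonempty → IsGreatest (connectedDensities G) (weightedArboricity G c)) ∧
      weightedArboricity G c = fractionalArboricity G ∧
      ⌈weightedArboricity G c⌉ = (arboricity G : ℤ) := by
  have heq : weightedArboricity G c = sSup (connectedDensities G) := by
    rw [weightedArboricity, weightedDensities_eq_connectedDensities hc]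
  refine ⟨fun h => ?_, ?_, ?_⟩
  · rw [← weightedDensities_eq_connectedDensities hc]
    exact isGreatest_weightedArboricity G c h
  · rw [heq, sSup_connectedDensities_eq_fractionalArboricity]
  -- Integer and natural ceilings agree because the supremum is nonnegative, being 0 for the empty
  -- family.
  · rw [heq, ← natCeil_sSup_connectedDensities_eq_arboricity,
      Int.natCast_ceil_eq_ceil (sSup_connectedDensities_nonneg G)]
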